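/- Planar pushing under bounded extremum seeking (ES), fixed goal. Let $r_1,r_2>0$ with $r_1\neq r_2$, let $M\in\mathbb{R}$ and let $\epsilon>0$. Then there exist gains $k,\alpha>0$ and a threshold $\omega^*>0$ (depending only on $r_1,r_2,M,\epsilon$) such that the following holds for every $\omega>\omega^*$. Let $g\in\mathbb{R}^2$ be a fixed goal, let $t_c\in\mathbb{R}$ be the time at which contact is established, and let $f_{\mathrm{fr}}:\mathbb{R}^2\to\mathbb{R}^2$ be any (unknown, position-dependent, possibly discontinuous) friction term with $\|f_{\mathrm{fr}}(x)\|_2\le M$ for all $x\in\mathbb{R}^2$. Put $J(x)=\|x-g\|_2$ and $\omega_i=r_i\omega$. Let $p:[t_c,\infty)\to\mathbb{R}^2$ be any trajectory of the object with contact maintained for all $t\ge t_c$, that is, any locally absolutely continuous solution (from any initial position $p(t_c)$, the equation holding for almost every $t\geq t_c$) of the ES-controlled system $$\dot p_i(t) = f_{\mathrm{fr},i}(p(t)) + \sqrt{\alpha\,\omega_i}\,\cos\bigl(\omega_i t + k\,J(p(t))\bigr),\qquad i=1,2 .$$ Then $p$ is driven into the $\epsilon$-neighborhood of $g$ and remains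 there: there is a time $T\ge t_c$ such that $\|p(t)-g\|_2<\epsilon$ for all $t\ge T$. -/

import Mathlib

open MeasureTheory

/-- The plane `ℝ²` of object positions, with the Euclidean norm. -/
abbrev Plane : Type := EuclideanSpace ℝ (Fin 2)

/-- The post-contact cost `J(p) = ‖p - g‖₂` for the fixed goal `g`. -/
noncomputable def pushCost (g p : Plane) : ℝ := ‖p - g‖

/-- The bounded extremum-seeking feedback with gain `k`, dither amplitude `α` and frequencies
`ωᵢ = rᵢ ω`: at time `t` and for the measured cost `y`, its `i`-th component is
`√(α ωᵢ) cos (ωᵢ t + k y)`. -/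
noncomputable def boundedES (r : Fin 2 → ℝ) (k α ω : ℝ) (t y : ℝ) : Plane :=
  WithLp.toLp 2 fun i => √(α * (r i * ω)) * Real.cos (r i * ω * t + k * y)

/-- The closed-loop velocity `f(p) + u(t, J(p))` of the object in contact, where `f` is the
position-dependent friction term and `u` the bounded extremum-seeking feedback. -/
noncomputable def pushField (f : Plane → Plane) (g : Plane) (r : Fin 2 → ℝ) (k α ω : ℝ)
    (t : ℝ) (p : Plane) : Plane :=
  f p + boundedES r k α ω t (pushCost g p)

/-- `p` is a trajectory on `[tc, ∞)` of the object under bounded extremum seeking, contact being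
maintained from the time `tc` on: a Carathéodory solution of `p' = f(p) + u(t, J(p))`, that is, a
locally absolutely continuous curve satisfying the equation at almost every time. This is written
as the integral equation. The friction need not be continuous. -/
structure IsESPushTrajectory (f : Plane → Plane) (g : Plane) (r : Fin 2 → ℝ) (k α ω : ℝ)
    (tc : ℝ) (p : ℝ → Plane) : Prop where
  intervalIntegrable : ∀ t, tc ≤ t →
    IntervalIntegrable (fun s => pushField f g r k α ω s (p s)) volume tc t
  eq_integral : ∀ t, tc ≤ t → p t = p tc + ∫ s in tc..t, pushField f g r k α ω s (p s)

/-!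
With `x = p - g`, `R = ‖x‖` and `ωᵢ = aᵢ²`, take `α = 1` and `k = 2 (|M| + 2)`. The phase
`θᵢ = ωᵢ t + k R` of the feedback is modulated by the distance, and on average this turns the dither
into a pull of strength `k / 2` towards the goal, which beats the friction. The friction is merely
bounded, so averaging theorems for regular vector fields do not apply; instead the averaging is
carried out by near-identity changes of the Lyapunov function, in which the friction is never
differentiated.

Subtracting the dither, `zᵢ = xᵢ - sin θᵢ / aᵢ` moves with velocity `fᵢ - k R' cos θᵢ / aᵢ`, which
is bounded uniformly in `ω`, although the velocity of `x` is of order `√ω`. So the unit vector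
`m = z / ‖z‖` varies slowly away from the goal, and inserting `R' ≈ ∑ mⱼ aⱼ cos θⱼ` gives
`‖z‖' ≈ m · f - k (∑ mⱼ aⱼ cos θⱼ) (∑ mᵢ cos θᵢ / aᵢ)` (`shiftedDist_rate_le`). The product of the
two sums is `1 / 2` plus terms oscillating at the frequencies `2 ωᵢ` and `ω₀ ± ω₁`
(`dither_products_eq`); `r₀ ≠ r₁` makes all of these nonzero and of order `ω`, so that the
oscillating terms have primitives of order `1 / ω` (`averagingCorrection`). Adding these primitives
to `‖z‖` yields a function `esLyapunov` within `O(1 / √ω)` of `R` whose derivative is at most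
`|M| - k / 2 + O(1 / √ω) ≤ -1` as long as `R ≥ δ` (`exists_hasDerivAt_esLyapunov`). The errors depend
on `δ` but not on the initial position, because the gradient of the cost is bounded.

Consequently `R` reaches `δ = ε / 4`, and after the last visit to the ball of radius `δ` it exceeds
`δ` by `O(1 / √ω)` only (`exists_forall_le_add_of_decrease`). Trajectories are differentiable almost
everywhere only; the decrease is integrated by the fundamental theorem of calculus for absolutely
continuous functions (`comp_le_comp_sub_of_ae_hasDerivAt_le`).
-/

/-! ### Differential inequalities along Lipschitz curves -/

/-- Integrated differential inequality for a `C¹` function along a Lipschitz curve. The curve is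
differentiable almost everywhere only, so the composite is shown to be Lipschitz, hence absolutely
continuous, and the fundamental theorem of calculus for such functions is applied. -/
lemma comp_le_comp_sub_of_ae_hasDerivAt_le {E : Type*} [NormedAddCommGroup E] [NormedSpace ℝ E]
    {γ : ℝ → E} {F : E → ℝ} {s t c : ℝ} {K : NNReal} (hst : s ≤ t)
    (hγ : LipschitzOnWith K γ (Set.Icc s t))
    (hF : ∀ u ∈ Set.Icc s t, ContDiffAt ℝ 1 F (γ u))
    (hderiv : ∀ᵐ u, u ∈ Set.Icc s t → ∃ w, HasDerivAt (fun v => F (γ v)) w u ∧ w ≤ -c) :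
    F (γ t) ≤ F (γ s) - c * (t - s) := by
  have hloc : LocallyLipschitzOn (Set.Icc s t) (fun v => F (γ v)) := by
    intro u hu
    obtain ⟨K', V, hV, hK'⟩ := (hF u hu).exists_lipschitzOnWith
    refine ⟨K' * K, γ ⁻¹' V ∩ Set.Icc s t,
      Filter.inter_mem ((hγ.continuousOn u hu) hV) self_mem_nhdsWithin, ?_⟩
    exact hK'.comp (hγ.mono Set.inter_subset_right) fun v hv => hv.1
  obtain ⟨K', hK'⟩ := hloc.exists_lipschitzOnWith_of_compact isCompact_Icc
  rw [← Set.uIcc_of_le hst] at hK'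
  have hac := hK'.absolutelyContinuousOnInterval
  have hle : ∫ u in s..t, deriv (fun v => F (γ v)) u ≤ ∫ _u in s..t, -c := by
    refine intervalIntegral.integral_mono_ae_restrict hst hac.intervalIntegrable_deriv
      intervalIntegrable_const ?_
    refine (ae_restrict_iff' measurableSet_Icc).2 ?_
    filter_upwards [hderiv] with u hu hmem
    obtain ⟨w, hw, hwc⟩ := hu hmem
    rw [hw.deriv]
    exact hwc
  rw [hac.integral_deriv_eq_sub, intervalIntegral.integral_const, smul_eq_mul] at hle
  linarith

/-- If a nonnegative continuous function decreases at unit rate, up to a fixed slack `η`, on every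
time interval on which it stays above the level `δ`, then it is eventually at most `δ + η`. -/
lemma exists_forall_le_add_of_decrease {R : ℝ → ℝ} {tc δ η : ℝ}
    (hR : ContinuousOn R (Set.Ici tc)) (hR0 : ∀ t, 0 ≤ R t) (hη : 0 ≤ η)
    (hdec : ∀ s t, tc ≤ s → s ≤ t → (∀ u ∈ Set.Icc s t, δ ≤ R u) → R t ≤ R s + η - (t - s)) :
    ∃ T, tc ≤ T ∧ ∀ t, T ≤ t → R t ≤ δ + η := by
  obtain ⟨T, hT, hRT⟩ : ∃ T, tc ≤ T ∧ R T ≤ δ := by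
    by_contra! hcon
    have h := hdec tc (tc + (R tc + η + 1)) le_rfl (by linarith [hR0 tc])
      fun u hu => (hcon u hu.1).le
    linarith [hR0 (tc + (R tc + η + 1))]
  refine ⟨T, hT, fun t ht => ?_⟩
  -- `s` is the last time before `t` at which the function is at most `δ`.
  let A : Set ℝ := Set.Icc T t ∩ R ⁻¹' Set.Iic δ
  have hcont : ContinuousOn R (Set.Icc T t) := hR.mono fun u hu => hT.trans hu.1
  have hA : IsCompact A :=
    isCompact_Icc.of_isClosed_subset (hcont.preimage_isClosed_of_isClosed isClosed_Icc isClosed_Iic)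
      Set.inter_subset_left
  obtain ⟨s, ⟨hsT, hRs⟩, hmax⟩ := hA.exists_isGreatest ⟨T, ⟨le_rfl, ht⟩, hRT⟩
  have hgt : ∀ u ∈ Set.Ioc s t, δ ≤ R u := fun u hu => by
    by_contra! hlt
    exact absurd (hmax ⟨⟨hsT.1.trans hu.1.le, hu.2⟩, hlt.le⟩) (not_le.2 hu.1)
  rcases hsT.2.eq_or_lt with rfl | hlt
  · exact (show R s ≤ δ from hRs).trans (by linarith)
  · have hδ : δ ≤ R s := by
      have hs : Filter.Tendsto R (nhdsWithin s (Set.Ioc s t)) (nhds (R s)) :=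
        (hcont s hsT).mono fun u hu => ⟨hsT.1.trans hu.1.le, hu.2⟩
      have : (nhdsWithin s (Set.Ioc s t)).NeBot := by
        rw [nhdsWithin_Ioc_eq_nhdsGT hlt]; infer_instance
      exact ge_of_tendsto hs (Filter.eventually_of_mem self_mem_nhdsWithin hgt)
    have h := hdec s t (hT.trans hsT.1) hlt.le fun u hu => by
      rcases hu.1.eq_or_lt with rfl | h
      · exact hδ
      · exact hgt u ⟨h, hu.2⟩
    have : R s ≤ δ := hRs
    linarith

/-! ### Polar coordinates in the plane -/

lemma abs_mul_le_mul_of_abs_le {x y A B : ℝ} (hx : |x| ≤ A) (hy : |y| ≤ B) : |x * y| ≤ A * B := by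
  rw [abs_mul]
  exact mul_le_mul hx hy (abs_nonneg y) ((abs_nonneg x).trans hx)

/-- The Euclidean norm of the vector `(x, y)`. -/
noncomputable def radius (x y : ℝ) : ℝ := √(x ^ 2 + y ^ 2)

lemma radius_nonneg (x y : ℝ) : 0 ≤ radius x y := Real.sqrt_nonneg _

lemma radius_sq (x y : ℝ) : radius x y ^ 2 = x ^ 2 + y ^ 2 := Real.sq_sqrt (by positivity)

lemma abs_fst_le_radius (x y : ℝ) : |x| ≤ radius x y := by
  rw [← Real.sqrt_sq_eq_abs]
  exact Real.sqrt_le_sqrt (by nlinarith)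

lemma abs_snd_le_radius (x y : ℝ) : |y| ≤ radius x y := by
  rw [← Real.sqrt_sq_eq_abs]
  exact Real.sqrt_le_sqrt (by nlinarith)

lemma abs_radius_sub_radius_le (x y x' y' : ℝ) :
    |radius x y - radius x' y'| ≤ |x - x'| + |y - y'| := by
  have key : ∀ a b c d : ℝ, radius a b ≤ radius c d + (|a - c| + |b - d|) := fun a b c d => by
    refine Real.sqrt_le_iff.2 ⟨by positivity [radius_nonneg c d], ?_⟩
    have h0 := radius_sq c d
    have h1 := abs_fst_le_radius c d
    have h2 := abs_snd_le_radius c d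
    have h3 : c * (a - c) ≤ radius c d * |a - c| :=
      (le_abs_self _).trans (abs_mul_le_mul_of_abs_le h1 le_rfl)
    have h4 : d * (b - d) ≤ radius c d * |b - d| :=
      (le_abs_self _).trans (abs_mul_le_mul_of_abs_le h2 le_rfl)
    nlinarith [sq_abs (a - c), sq_abs (b - d), mul_nonneg (abs_nonneg (a - c)) (abs_nonneg (b - d))]
  rw [abs_le]
  constructor
  · have := key x' y' x y
    rw [abs_sub_comm x' x, abs_sub_comm y' y] at this
    linarith
  · linarith [key x y x' y']

lemma abs_fst_div_radius_le_one (x y : ℝ) : |x / radius x y| ≤ 1 := by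
  rw [abs_div, abs_of_nonneg (radius_nonneg x y)]
  exact div_le_one_of_le₀ (abs_fst_le_radius x y) (radius_nonneg x y)

lemma abs_snd_div_radius_le_one (x y : ℝ) : |y / radius x y| ≤ 1 := by
  rw [abs_div, abs_of_nonneg (radius_nonneg x y)]
  exact div_le_one_of_le₀ (abs_snd_le_radius x y) (radius_nonneg x y)

lemma div_radius_sq_add_div_radius_sq {x y : ℝ} (h : 0 < radius x y) :
    (x / radius x y) ^ 2 + (y / radius x y) ^ 2 = 1 := by
  rw [div_pow, div_pow, ← add_div, ← radius_sq, div_self (by positivity)]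

/-- The unit vectors of two nearby vectors are close. -/
lemma abs_div_sub_div_le {u u' r r' e δ : ℝ} (hδ : 0 < δ) (hr : δ ≤ r) (hr' : 0 < r')
    (hu' : |u' / r'| ≤ 1) (hu : |u - u'| ≤ e) (hrr : |r - r'| ≤ e) :
    |u / r - u' / r'| ≤ 2 * e / δ := by
  have hr0 : 0 < r := hδ.trans_le hr
  have he : 0 ≤ e := (abs_nonneg _).trans hu
  have h : u / r - u' / r' = ((u - u') - u' / r' * (r - r')) / r := by
    field_simp
    ring
  rw [h, abs_div, abs_of_pos hr0]
  have h1 : |(u - u') - u' / r' * (r - r')| ≤ 2 * e := by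
    have := abs_sub (u - u') (u' / r' * (r - r'))
    have := abs_mul_le_mul_of_abs_le hu' hrr
    linarith
  exact (div_le_div_of_nonneg_right h1 hr0.le).trans
    (div_le_div_of_nonneg_left (by positivity) hδ hr)

lemma hasDerivAt_radius {x y : ℝ → ℝ} {x' y' t : ℝ} (hx : HasDerivAt x x' t)
    (hy : HasDerivAt y y' t) (h : 0 < radius (x t) (y t)) :
    HasDerivAt (fun s => radius (x s) (y s))
      (x t / radius (x t) (y t) * x' + y t / radius (x t) (y t) * y') t := by
  have hne : x t ^ 2 + y t ^ 2 ≠ 0 := by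
    rw [← radius_sq]
    positivity
  refine (((hx.pow 2).add (hy.pow 2)).sqrt hne).congr_deriv ?_
  have : √((x ^ 2 + y ^ 2) t) = radius (x t) (y t) := rfl
  simp only [Pi.add_apply, Pi.pow_apply] at *
  rw [this]
  field_simp
  push_cast
  ring

lemma exists_hasDerivAt_div {u r : ℝ → ℝ} {u' r' t B δ : ℝ} (hu : HasDerivAt u u' t)
    (hr : HasDerivAt r r' t) (hδ : 0 < δ) (hδr : δ ≤ r t) (hur : |u t / r t| ≤ 1)
    (hB : |u'| ≤ B) (hB' : |r'| ≤ 2 * B) :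
    ∃ m', HasDerivAt (fun s => u s / r s) m' t ∧ |m'| ≤ 3 * B / δ := by
  have hr0 : 0 < r t := hδ.trans_le hδr
  have hBnn : 0 ≤ B := (abs_nonneg _).trans hB
  refine ⟨(u' - u t / r t * r') / r t, (hu.div hr hr0.ne').congr_deriv ?_, ?_⟩
  · field_simp
  · rw [abs_div, abs_of_pos hr0]
    have h1 : |u' - u t / r t * r'| ≤ 3 * B := by
      have := abs_sub u' (u t / r t * r')
      have := abs_mul_le_mul_of_abs_le hur hB'
      linarith
    exact (div_le_div_of_nonneg_right h1 hr0.le).trans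
      (div_le_div_of_nonneg_left (by positivity) hδ hδr)

/-! ### The averaging correction -/

/-- The dither amplitudes `aᵢ = √ωᵢ` are of order `τ⁻¹` for a small `τ`, uniformly in the constant
`C`, and the two frequencies `aᵢ²` are separated at the same scale. -/
structure IsFastDither (a₀ a₁ τ C : ℝ) : Prop where
  pos₀ : 0 < a₀
  pos₁ : 0 < a₁
  tau_pos : 0 < τ
  tau_le_one : τ ≤ 1
  one_le : 1 ≤ C
  mul_le₀ : a₀ * τ ≤ C
  mul_le₁ : a₁ * τ ≤ C
  inv_le₀ : 1 / a₀ ≤ C * τ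
  inv_le₁ : 1 / a₁ ≤ C * τ
  gap_ne : a₀ ^ 2 - a₁ ^ 2 ≠ 0
  inv_gap_le : |1 / (a₀ ^ 2 - a₁ ^ 2)| ≤ C * τ ^ 2

namespace IsFastDither

variable {a₀ a₁ τ C : ℝ}

lemma inv_sq_le₀ (h : IsFastDither a₀ a₁ τ C) : 1 / a₀ ^ 2 ≤ C ^ 2 * τ ^ 2 := by
  have := pow_le_pow_left₀ (one_div_nonneg.2 h.pos₀.le) h.inv_le₀ 2
  rwa [div_pow, one_pow, mul_pow] at this

lemma inv_sq_le₁ (h : IsFastDither a₀ a₁ τ C) : 1 / a₁ ^ 2 ≤ C ^ 2 * τ ^ 2 := by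
  have := pow_le_pow_left₀ (one_div_nonneg.2 h.pos₁.le) h.inv_le₁ 2
  rwa [div_pow, one_pow, mul_pow] at this

lemma sq_tau_le (h : IsFastDither a₀ a₁ τ C) : C ^ 2 * τ ^ 2 ≤ C ^ 2 * τ := by
  have := h.tau_pos
  have := h.tau_le_one
  gcongr
  nlinarith

lemma ratio_nonneg (h : IsFastDither a₀ a₁ τ C) : 0 ≤ a₀ / a₁ + a₁ / a₀ := by
  have := h.pos₀
  have := h.pos₁
  positivity

lemma ratio_le (h : IsFastDither a₀ a₁ τ C) : a₀ / a₁ + a₁ / a₀ ≤ 2 * C ^ 2 := by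
  have hC := h.one_le
  have h0 : a₀ * (1 / a₁) ≤ a₀ * (C * τ) := mul_le_mul_of_nonneg_left h.inv_le₁ h.pos₀.le
  have h1 : a₁ * (1 / a₀) ≤ a₁ * (C * τ) := mul_le_mul_of_nonneg_left h.inv_le₀ h.pos₁.le
  have h2 := mul_le_mul_of_nonneg_left h.mul_le₀ (zero_le_one.trans hC)
  have h3 := mul_le_mul_of_nonneg_left h.mul_le₁ (zero_le_one.trans hC)
  rw [mul_one_div] at h0 h1
  nlinarith

end IsFastDither

/-- The term which, along the closed loop, compensates the oscillating part of the decrease of the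
shifted distance. Here `(m₀, m₁)` is a unit vector, varying slowly, and `θ₀, θ₁` are the phases,
varying at rates close to `a₀²` and `a₁²`. -/
noncomputable def averagingCorrection (a₀ a₁ θ₀ θ₁ m₀ m₁ : ℝ) : ℝ :=
  m₀ * m₀ * (Real.sin (2 * θ₀) / (2 * a₀ ^ 2)) + m₁ * m₁ * (Real.sin (2 * θ₁) / (2 * a₁ ^ 2))
    + m₀ * m₁ * ((a₀ / a₁ + a₁ / a₀) * (Real.sin (θ₀ + θ₁) / (a₀ ^ 2 + a₁ ^ 2)
      + Real.sin (θ₀ - θ₁) / (a₀ ^ 2 - a₁ ^ 2)))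

/-- The zero-mean part of the decrease rate of the shifted distance. -/
noncomputable def ditherOscillation (a₀ a₁ θ₀ θ₁ m₀ m₁ : ℝ) : ℝ :=
  m₀ * m₀ * Real.cos (2 * θ₀) + m₁ * m₁ * Real.cos (2 * θ₁)
    + m₀ * m₁ * ((a₀ / a₁ + a₁ / a₀) * (Real.cos (θ₀ + θ₁) + Real.cos (θ₀ - θ₁)))

lemma abs_sin_div_le {φ d Q : ℝ} (h : |1 / d| ≤ Q) : |Real.sin φ / d| ≤ Q := by
  rw [← mul_one_div]
  simpa using abs_mul_le_mul_of_abs_le (Real.abs_sin_le_one φ) h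

section
variable {a₀ a₁ τ C : ℝ}

lemma IsFastDither.abs_inv_bounds (h : IsFastDither a₀ a₁ τ C) :
    |1 / (2 * a₀ ^ 2)| ≤ C ^ 2 * τ ∧ |1 / (2 * a₁ ^ 2)| ≤ C ^ 2 * τ ∧
      |1 / (a₀ ^ 2 + a₁ ^ 2)| ≤ C ^ 2 * τ ∧ |1 / (a₀ ^ 2 - a₁ ^ 2)| ≤ C ^ 2 * τ := by
  have h0 := pow_pos h.pos₀ 2
  have h1 := pow_pos h.pos₁ 2
  have e0 := h.inv_sq_le₀.trans h.sq_tau_le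
  have e1 := h.inv_sq_le₁.trans h.sq_tau_le
  refine ⟨?_, ?_, ?_, ?_⟩
  · rw [abs_of_pos (by positivity)]
    exact (one_div_le_one_div_of_le h0 (by linarith)).trans e0
  · rw [abs_of_pos (by positivity)]
    exact (one_div_le_one_div_of_le h1 (by linarith)).trans e1
  · rw [abs_of_pos (by positivity)]
    exact (one_div_le_one_div_of_le h0 (by linarith)).trans e0
  · refine h.inv_gap_le.trans (le_trans ?_ h.sq_tau_le)
    have := h.one_le
    gcongr
    nlinarith

lemma abs_averagingCorrection_le (h : IsFastDither a₀ a₁ τ C) {θ₀ θ₁ m₀ m₁ : ℝ}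
    (hm₀ : |m₀| ≤ 1) (hm₁ : |m₁| ≤ 1) :
    |averagingCorrection a₀ a₁ θ₀ θ₁ m₀ m₁| ≤ (2 + 4 * C ^ 2) * C ^ 2 * τ := by
  obtain ⟨b0, b1, b2, b3⟩ := h.abs_inv_bounds
  have hκ : |a₀ / a₁ + a₁ / a₀| ≤ 2 * C ^ 2 := by
    rw [abs_of_nonneg h.ratio_nonneg]; exact h.ratio_le
  have t0 := abs_mul_le_mul_of_abs_le (abs_mul_le_mul_of_abs_le hm₀ hm₀)
    (abs_sin_div_le (φ := 2 * θ₀) b0)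
  have t1 := abs_mul_le_mul_of_abs_le (abs_mul_le_mul_of_abs_le hm₁ hm₁)
    (abs_sin_div_le (φ := 2 * θ₁) b1)
  have t2 := abs_mul_le_mul_of_abs_le (abs_mul_le_mul_of_abs_le hm₀ hm₁)
    (abs_mul_le_mul_of_abs_le hκ ((abs_add_le _ _).trans
      (add_le_add (abs_sin_div_le (φ := θ₀ + θ₁) b2) (abs_sin_div_le (φ := θ₀ - θ₁) b3))))
  refine (abs_add_le _ _).trans ((add_le_add ((abs_add_le _ _).trans (add_le_add t0 t1)) t2).trans
    (le_of_eq ?_))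
  ring

/-- The derivative of the averaging correction along the closed loop is the oscillation, up to an
error of order `τ`. -/
lemma exists_hasDerivAt_averagingCorrection (h : IsFastDither a₀ a₁ τ C) {D N k d t : ℝ}
    {θ₀ θ₁ m₀ m₁ : ℝ → ℝ} {m₀' m₁' : ℝ} (hk : 0 < k)
    (hθ₀ : HasDerivAt θ₀ (a₀ ^ 2 + k * d) t) (hθ₁ : HasDerivAt θ₁ (a₁ ^ 2 + k * d) t)
    (hm₀ : HasDerivAt m₀ m₀' t) (hm₁ : HasDerivAt m₁ m₁' t)
    (hm₀1 : |m₀ t| ≤ 1) (hm₁1 : |m₁ t| ≤ 1) (hm₀' : |m₀'| ≤ N) (hm₁' : |m₁'| ≤ N)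
    (hd : |d| * τ ≤ D) :
    ∃ w, HasDerivAt (fun s => averagingCorrection a₀ a₁ (θ₀ s) (θ₁ s) (m₀ s) (m₁ s)) w t ∧
      w ≤ ditherOscillation a₀ a₁ (θ₀ t) (θ₁ t) (m₀ t) (m₁ t)
        + ((2 + 2 * C ^ 2) * (2 * k * D) + (4 + 8 * C ^ 2) * N) * C ^ 2 * τ := by
  have hp0 := h.pos₀
  have hp1 := h.pos₁
  have hgap := h.gap_ne
  obtain ⟨b0, b1, b2, b3⟩ := h.abs_inv_bounds
  have hκ : |a₀ / a₁ + a₁ / a₀| ≤ 2 * C ^ 2 := by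
    rw [abs_of_nonneg h.ratio_nonneg]; exact h.ratio_le
  have hτ := h.tau_pos
  have s0 := ((hθ₀.const_mul 2).sin.div_const (2 * a₀ ^ 2))
  have s1 := ((hθ₁.const_mul 2).sin.div_const (2 * a₁ ^ 2))
  have s2 := ((hθ₀.add hθ₁).sin.div_const (a₀ ^ 2 + a₁ ^ 2))
  have s3 := ((hθ₀.sub hθ₁).sin.div_const (a₀ ^ 2 - a₁ ^ 2))
  have hder := (((hm₀.mul hm₀).mul s0).add ((hm₁.mul hm₁).mul s1)).add
    ((hm₀.mul hm₁).mul ((s2.add s3).const_mul (a₀ / a₁ + a₁ / a₀)))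
  refine ⟨_, hder, ?_⟩
  -- A frequency shift `2 k d` relative to a frequency of order `τ⁻²` is of order `τ`.
  have hshift : ∀ {q : ℝ}, |1 / q| ≤ C ^ 2 * τ ^ 2 → ∀ φ : ℝ,
      |Real.cos φ * (2 * k * d / q)| ≤ 2 * k * D * C ^ 2 * τ := fun {q} hq φ => by
    have h1 := abs_mul_le_mul_of_abs_le (Real.abs_cos_le_one φ)
      (abs_mul_le_mul_of_abs_le (le_refl |2 * k * d|) hq)
    rw [mul_one_div, abs_mul (2 * k) d, abs_of_pos (by positivity : 0 < 2 * k)] at h1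
    have h2 : 2 * k * C ^ 2 * τ * (|d| * τ) ≤ 2 * k * C ^ 2 * τ * D :=
      mul_le_mul_of_nonneg_left hd (by positivity)
    linarith
  have q0 : |1 / (2 * a₀ ^ 2)| ≤ C ^ 2 * τ ^ 2 := by
    rw [abs_of_pos (by positivity)]
    refine (one_div_le_one_div_of_le (by positivity) ?_).trans h.inv_sq_le₀
    nlinarith
  have q1 : |1 / (2 * a₁ ^ 2)| ≤ C ^ 2 * τ ^ 2 := by
    rw [abs_of_pos (by positivity)]
    refine (one_div_le_one_div_of_le (by positivity) ?_).trans h.inv_sq_le₁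
    nlinarith
  have q2 : |1 / (a₀ ^ 2 + a₁ ^ 2)| ≤ C ^ 2 * τ ^ 2 := by
    rw [abs_of_pos (by positivity)]
    refine (one_div_le_one_div_of_le (by positivity) ?_).trans h.inv_sq_le₀
    nlinarith
  have g0 := le_of_abs_le (abs_mul_le_mul_of_abs_le (abs_mul_le_mul_of_abs_le hm₀1 hm₀1)
    (hshift q0 (2 * θ₀ t)))
  have g1 := le_of_abs_le (abs_mul_le_mul_of_abs_le (abs_mul_le_mul_of_abs_le hm₁1 hm₁1)
    (hshift q1 (2 * θ₁ t)))
  have g2 := le_of_abs_le (abs_mul_le_mul_of_abs_le (abs_mul_le_mul_of_abs_le hm₀1 hm₁1)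
    (abs_mul_le_mul_of_abs_le hκ (hshift q2 (θ₀ t + θ₁ t))))
  have l0 := le_of_abs_le (abs_mul_le_mul_of_abs_le (abs_mul_le_mul_of_abs_le hm₀' hm₀1)
    (abs_sin_div_le (φ := 2 * θ₀ t) b0))
  have l1 := le_of_abs_le (abs_mul_le_mul_of_abs_le (abs_mul_le_mul_of_abs_le hm₁' hm₁1)
    (abs_sin_div_le (φ := 2 * θ₁ t) b1))
  have hS := abs_mul_le_mul_of_abs_le hκ ((abs_add_le _ _).trans
      (add_le_add (abs_sin_div_le (φ := θ₀ t + θ₁ t) b2) (abs_sin_div_le (φ := θ₀ t - θ₁ t) b3)))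
  have l2 := le_of_abs_le (abs_mul_le_mul_of_abs_le (abs_mul_le_mul_of_abs_le hm₀' hm₁1) hS)
  have l3 := le_of_abs_le (abs_mul_le_mul_of_abs_le (abs_mul_le_mul_of_abs_le hm₀1 hm₁') hS)
  have c0 : Real.cos (2 * θ₀ t) * (2 * (a₀ ^ 2 + k * d)) / (2 * a₀ ^ 2)
      = Real.cos (2 * θ₀ t) + Real.cos (2 * θ₀ t) * (2 * k * d / (2 * a₀ ^ 2)) := by
    field_simp
  have c1 : Real.cos (2 * θ₁ t) * (2 * (a₁ ^ 2 + k * d)) / (2 * a₁ ^ 2)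
      = Real.cos (2 * θ₁ t) + Real.cos (2 * θ₁ t) * (2 * k * d / (2 * a₁ ^ 2)) := by
    field_simp
  have c2 : Real.cos (θ₀ t + θ₁ t) * (a₀ ^ 2 + k * d + (a₁ ^ 2 + k * d)) / (a₀ ^ 2 + a₁ ^ 2)
      = Real.cos (θ₀ t + θ₁ t)
        + Real.cos (θ₀ t + θ₁ t) * (2 * k * d / (a₀ ^ 2 + a₁ ^ 2)) := by
    field_simp
    ring
  -- The feedback shifts both frequencies equally: their difference is exactly `a₀² - a₁²`.
  have c3 : Real.cos (θ₀ t - θ₁ t) * (a₀ ^ 2 + k * d - (a₁ ^ 2 + k * d)) / (a₀ ^ 2 - a₁ ^ 2)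
      = Real.cos (θ₀ t - θ₁ t) := by
    rw [add_sub_add_right_eq_sub, mul_div_assoc, div_self hgap, mul_one]
  simp only [Pi.add_apply, Pi.mul_apply, Pi.sub_apply, c0, c1, c2, c3]
  unfold ditherOscillation
  linarith

end

/-! ### The Lyapunov function -/

/-- The phase `aᵢ² t + k J` of a component of the feedback, the frequency being `ωᵢ = aᵢ²`. -/
noncomputable def ditherPhase (a k t R : ℝ) : ℝ := a ^ 2 * t + k * R

/-- A coordinate of the object relative to the goal with the primitive `sin θ / a` of the dither
removed: unlike the coordinate itself, it moves at a speed that stays bounded as `a → ∞`. -/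
noncomputable def shiftedCoord (a k t R u : ℝ) : ℝ := u - Real.sin (ditherPhase a k t R) / a

/-- The distance to the goal after removal of the dither. -/
noncomputable def shiftedDist (a₀ a₁ k t x y : ℝ) : ℝ :=
  radius (shiftedCoord a₀ k t (radius x y) x) (shiftedCoord a₁ k t (radius x y) y)

/-- The Lyapunov function: the shifted distance, with its oscillating decrease rate averaged. -/
noncomputable def esLyapunov (a₀ a₁ k t x y : ℝ) : ℝ :=
  shiftedDist a₀ a₁ k t x y + k / 2 * averagingCorrection a₀ a₁
    (ditherPhase a₀ k t (radius x y)) (ditherPhase a₁ k t (radius x y))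
    (shiftedCoord a₀ k t (radius x y) x / shiftedDist a₀ a₁ k t x y)
    (shiftedCoord a₁ k t (radius x y) y / shiftedDist a₀ a₁ k t x y)

section
variable {a₀ a₁ τ C : ℝ}

lemma abs_sub_shiftedCoord_le {a : ℝ} (ha : 0 < a) (h : 1 / a ≤ C * τ) (k t R u : ℝ) :
    |u - shiftedCoord a k t R u| ≤ C * τ := by
  unfold shiftedCoord
  rw [sub_sub_cancel]
  exact abs_sin_div_le (by rwa [abs_of_pos (by positivity)])

lemma IsFastDither.abs_radius_sub_shiftedDist_le (h : IsFastDither a₀ a₁ τ C) (k t x y : ℝ) :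
    |radius x y - shiftedDist a₀ a₁ k t x y| ≤ 2 * C * τ := by
  have h0 := abs_sub_shiftedCoord_le h.pos₀ h.inv_le₀ k t (radius x y) x
  have h1 := abs_sub_shiftedCoord_le h.pos₁ h.inv_le₁ k t (radius x y) y
  unfold shiftedDist
  linarith [abs_radius_sub_radius_le x y (shiftedCoord a₀ k t (radius x y) x)
    (shiftedCoord a₁ k t (radius x y) y)]

lemma IsFastDither.abs_esLyapunov_sub_radius_le (h : IsFastDither a₀ a₁ τ C) {k : ℝ} (hk : 0 < k)
    (t x y : ℝ) :
    |esLyapunov a₀ a₁ k t x y - radius x y| ≤ (2 * C + k / 2 * ((2 + 4 * C ^ 2) * C ^ 2)) * τ := by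
  have h0 := h.abs_radius_sub_shiftedDist_le k t x y
  have h1 := abs_averagingCorrection_le h (θ₀ := ditherPhase a₀ k t (radius x y))
    (θ₁ := ditherPhase a₁ k t (radius x y))
    (abs_fst_div_radius_le_one (shiftedCoord a₀ k t (radius x y) x)
      (shiftedCoord a₁ k t (radius x y) y))
    (abs_snd_div_radius_le_one (shiftedCoord a₀ k t (radius x y) x)
      (shiftedCoord a₁ k t (radius x y) y))
  have h2 := abs_mul_le_mul_of_abs_le (abs_of_pos (half_pos hk)).le h1
  rw [abs_sub_comm] at h0
  have h3 := (abs_add_le _ _).trans (add_le_add h0 h2)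
  unfold esLyapunov
  change |_ + k / 2 * averagingCorrection _ _ _ _ (_ / shiftedDist _ _ _ _ _ _)
    (_ / shiftedDist _ _ _ _ _ _)| ≤ _ at h3
  rw [add_sub_right_comm]
  linarith

/-- The feedback turns the dither into an average pull of strength `k / 2` towards the goal: the
squares of the cosines have mean `1 / 2`, all other products of cosines have mean zero. -/
lemma dither_products_eq (h : IsFastDither a₀ a₁ τ C) {θ₀ θ₁ m₀ m₁ : ℝ}
    (hm : m₀ ^ 2 + m₁ ^ 2 = 1) :
    (m₀ * (a₀ * Real.cos θ₀) + m₁ * (a₁ * Real.cos θ₁))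
        * (m₀ * (Real.cos θ₀ / a₀) + m₁ * (Real.cos θ₁ / a₁))
      = 1 / 2 * (1 + ditherOscillation a₀ a₁ θ₀ θ₁ m₀ m₁) := by
  have := h.pos₀.ne'
  have := h.pos₁.ne'
  have key : (m₀ * (a₀ * Real.cos θ₀) + m₁ * (a₁ * Real.cos θ₁))
        * (m₀ * (Real.cos θ₀ / a₀) + m₁ * (Real.cos θ₁ / a₁))
      = 1 / 2 * (m₀ ^ 2 + m₁ ^ 2 + ditherOscillation a₀ a₁ θ₀ θ₁ m₀ m₁) := by
    unfold ditherOscillation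
    rw [Real.cos_add, Real.cos_sub, Real.cos_two_mul, Real.cos_two_mul]
    field_simp
    ring
  rw [key, hm]

lemma mul_add_mul_le_of_sq_add_sq_le {m₀ m₁ f₀ f₁ b : ℝ} (hb : 0 ≤ b) (hm : m₀ ^ 2 + m₁ ^ 2 = 1)
    (hf : f₀ ^ 2 + f₁ ^ 2 ≤ b ^ 2) : m₀ * f₀ + m₁ * f₁ ≤ b := by
  refine le_of_sq_le_sq ?_ hb
  nlinarith [sq_nonneg (m₀ * f₁ - m₁ * f₀)]

/-- The decrease rate of the shifted distance. The direction `(n₀, n₁)` of the object from the goal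
may be replaced by that of its shifted position, `(m₀, m₁)`, at the cost of an error of
order `τ`. -/
lemma shiftedDist_rate_le (h : IsFastDither a₀ a₁ τ C) {k b G d θ₀ θ₁ m₀ m₁ n₀ n₁ f₀ f₁ : ℝ}
    (hk : 0 < k) (hb : 0 ≤ b) (hm : m₀ ^ 2 + m₁ ^ 2 = 1) (hm₀ : |m₀| ≤ 1) (hm₁ : |m₁| ≤ 1)
    (hn₀ : |n₀| ≤ 1) (hn₁ : |n₁| ≤ 1) (hnm₀ : |n₀ - m₀| ≤ G * τ) (hnm₁ : |n₁ - m₁| ≤ G * τ)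
    (hf : f₀ ^ 2 + f₁ ^ 2 ≤ b ^ 2) (hf₀ : |f₀| ≤ b) (hf₁ : |f₁| ≤ b)
    (hd : d = n₀ * (f₀ + a₀ * Real.cos θ₀) + n₁ * (f₁ + a₁ * Real.cos θ₁)) :
    m₀ * (f₀ - k * d * (Real.cos θ₀ / a₀)) + m₁ * (f₁ - k * d * (Real.cos θ₁ / a₁))
      ≤ b - k / 2 * (1 + ditherOscillation a₀ a₁ θ₀ θ₁ m₀ m₁)
        + 2 * k * C * (2 * b + 2 * G * C) * τ := by
  have hτ := h.tau_pos
  have hG : 0 ≤ G := by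
    have := (abs_nonneg _).trans hnm₀
    exact nonneg_of_mul_nonneg_left this hτ
  have hmf := mul_add_mul_le_of_sq_add_sq_le hb hm hf
  have hprod := dither_products_eq h (θ₀ := θ₀) (θ₁ := θ₁) hm
  have hX : |m₀ * (Real.cos θ₀ / a₀) + m₁ * (Real.cos θ₁ / a₁)| ≤ 2 * C * τ := by
    have c0 : |Real.cos θ₀ / a₀| ≤ C * τ := by
      rw [← mul_one_div]
      have h1 : |1 / a₀| ≤ C * τ := by
        rw [abs_of_pos (one_div_pos.2 h.pos₀)]; exact h.inv_le₀
      simpa using abs_mul_le_mul_of_abs_le (Real.abs_cos_le_one θ₀) h1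
    have c1 : |Real.cos θ₁ / a₁| ≤ C * τ := by
      rw [← mul_one_div]
      have h1 : |1 / a₁| ≤ C * τ := by
        rw [abs_of_pos (one_div_pos.2 h.pos₁)]; exact h.inv_le₁
      simpa using abs_mul_le_mul_of_abs_le (Real.abs_cos_le_one θ₁) h1
    have := (abs_add_le _ _).trans (add_le_add (abs_mul_le_mul_of_abs_le hm₀ c0)
      (abs_mul_le_mul_of_abs_le hm₁ c1))
    linarith
  have hE : |n₀ * f₀ + n₁ * f₁ + ((n₀ - m₀) * (a₀ * Real.cos θ₀) + (n₁ - m₁) * (a₁ * Real.cos θ₁))|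
      ≤ 2 * b + 2 * G * C := by
    have a0 : |a₀ * Real.cos θ₀| ≤ a₀ * 1 :=
      abs_mul_le_mul_of_abs_le (abs_of_pos h.pos₀).le (Real.abs_cos_le_one θ₀)
    have a1 : |a₁ * Real.cos θ₁| ≤ a₁ * 1 :=
      abs_mul_le_mul_of_abs_le (abs_of_pos h.pos₁).le (Real.abs_cos_le_one θ₁)
    have e := (abs_add_le _ _).trans (add_le_add
      ((abs_add_le _ _).trans (add_le_add (abs_mul_le_mul_of_abs_le hn₀ hf₀)
        (abs_mul_le_mul_of_abs_le hn₁ hf₁)))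
      ((abs_add_le _ _).trans (add_le_add (abs_mul_le_mul_of_abs_le hnm₀ a0)
        (abs_mul_le_mul_of_abs_le hnm₁ a1))))
    have g0 := mul_le_mul_of_nonneg_left h.mul_le₀ hG
    have g1 := mul_le_mul_of_nonneg_left h.mul_le₁ hG
    linarith
  have herr := neg_le_of_abs_le (abs_mul_le_mul_of_abs_le hE hX)
  have herr' := mul_le_mul_of_nonneg_left herr hk.le
  have hsplit : d = (m₀ * (a₀ * Real.cos θ₀) + m₁ * (a₁ * Real.cos θ₁))
      + (n₀ * f₀ + n₁ * f₁
        + ((n₀ - m₀) * (a₀ * Real.cos θ₀) + (n₁ - m₁) * (a₁ * Real.cos θ₁))) := by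
    rw [hd]; ring
  have heq : m₀ * (f₀ - k * d * (Real.cos θ₀ / a₀)) + m₁ * (f₁ - k * d * (Real.cos θ₁ / a₁))
      = m₀ * f₀ + m₁ * f₁ - k * (d * (m₀ * (Real.cos θ₀ / a₀) + m₁ * (Real.cos θ₁ / a₁))) := by
    ring
  rw [heq, hsplit, add_mul, hprod]
  linarith

/-- The constant in front of the small parameter in the derivative of the Lyapunov function, for
friction bounded by `b` and at distance at least `δ` from the goal. -/
noncomputable def esRateConst (b k C δ : ℝ) : ℝ :=
  2 * k * C * (2 * b + 2 * (4 * C / δ) * C)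
    + k / 2 * (((2 + 2 * C ^ 2) * (2 * k * (2 * b + 2 * C))
      + (4 + 8 * C ^ 2) * (3 * (b + k * (2 * b + 2 * C) * C) / (δ / 2))) * C ^ 2)

lemma IsFastDither.half_le_shiftedDist (h : IsFastDither a₀ a₁ τ C) {δ k t x y : ℝ}
    (hδ : 4 * C * τ ≤ δ) (hR : δ ≤ radius x y) : δ / 2 ≤ shiftedDist a₀ a₁ k t x y := by
  have := le_of_abs_le (h.abs_radius_sub_shiftedDist_le k t x y)
  linarith

lemma hasDerivAt_ditherPhase (a k : ℝ) {t d : ℝ} {R : ℝ → ℝ} (hR : HasDerivAt R d t) :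
    HasDerivAt (fun s => ditherPhase a k s (R s)) (a ^ 2 + k * d) t :=
  (((hasDerivAt_id t).const_mul (a ^ 2)).add (hR.const_mul k)).congr_deriv (by rw [mul_one])

lemma hasDerivAt_shiftedCoord {a k t d v : ℝ} {R u : ℝ → ℝ} (ha : 0 < a)
    (hR : HasDerivAt R d t)
    (hu : HasDerivAt u (v + a * Real.cos (ditherPhase a k t (R t))) t) :
    HasDerivAt (fun s => shiftedCoord a k s (R s) (u s))
      (v - k * d * (Real.cos (ditherPhase a k t (R t)) / a)) t := by
  have hθ := hasDerivAt_ditherPhase a k hR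
  refine (hu.sub (hθ.sin.div_const a)).congr_deriv ?_
  field_simp
  ring

/-- Away from the goal, the Lyapunov function decreases along the closed loop at a rate of at least
`k / 2 - b`, up to an error of order `τ`. -/
lemma exists_hasDerivAt_esLyapunov (h : IsFastDither a₀ a₁ τ C) {b k δ t f₀ f₁ : ℝ}
    {x y : ℝ → ℝ} (hk : 0 < k) (hb : 0 ≤ b) (hδ0 : 0 < δ) (hδ : 4 * C * τ ≤ δ)
    (hf : f₀ ^ 2 + f₁ ^ 2 ≤ b ^ 2) (hR : δ ≤ radius (x t) (y t))
    (hx : HasDerivAt x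
      (f₀ + a₀ * Real.cos (ditherPhase a₀ k t (radius (x t) (y t)))) t)
    (hy : HasDerivAt y
      (f₁ + a₁ * Real.cos (ditherPhase a₁ k t (radius (x t) (y t)))) t) :
    ∃ w, HasDerivAt (fun s => esLyapunov a₀ a₁ k s (x s) (y s)) w t ∧
      w ≤ b - k / 2 + esRateConst b k C δ * τ := by
  have hτ := h.tau_pos
  have hC := zero_lt_one.trans_le h.one_le
  have hf₀ : |f₀| ≤ b := abs_le_of_sq_le_sq (by nlinarith) hb
  have hf₁ : |f₁| ≤ b := abs_le_of_sq_le_sq (by nlinarith) hb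
  have hn₀ := abs_fst_div_radius_le_one (x t) (y t)
  have hn₁ := abs_snd_div_radius_le_one (x t) (y t)
  have hdR := hasDerivAt_radius hx hy (hδ0.trans_le hR)
  obtain ⟨d, hd⟩ : ∃ d, d = x t / radius (x t) (y t)
        * (f₀ + a₀ * Real.cos (ditherPhase a₀ k t (radius (x t) (y t))))
      + y t / radius (x t) (y t)
        * (f₁ + a₁ * Real.cos (ditherPhase a₁ k t (radius (x t) (y t)))) := ⟨_, rfl⟩
  rw [← hd] at hdR
  have hdτ : |d| * τ ≤ 2 * b + 2 * C := by
    have v0 := (abs_add_le f₀ _).trans (add_le_add hf₀ (abs_mul_le_mul_of_abs_le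
      (abs_of_pos h.pos₀).le (Real.abs_cos_le_one (ditherPhase a₀ k t (radius (x t) (y t))))))
    have v1 := (abs_add_le f₁ _).trans (add_le_add hf₁ (abs_mul_le_mul_of_abs_le
      (abs_of_pos h.pos₁).le (Real.abs_cos_le_one (ditherPhase a₁ k t (radius (x t) (y t))))))
    have hd1 := (abs_add_le _ _).trans (add_le_add (abs_mul_le_mul_of_abs_le hn₀ v0)
      (abs_mul_le_mul_of_abs_le hn₁ v1))
    rw [← hd] at hd1
    have := mul_le_mul_of_nonneg_right hd1 hτ.le
    nlinarith [h.mul_le₀, h.mul_le₁, h.tau_le_one]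
  have hθ₀ := hasDerivAt_ditherPhase a₀ k hdR
  have hθ₁ := hasDerivAt_ditherPhase a₁ k hdR
  have hz₀ := hasDerivAt_shiftedCoord h.pos₀ hdR hx
  have hz₁ := hasDerivAt_shiftedCoord h.pos₁ hdR hy
  have hρ := h.half_le_shiftedDist (k := k) (t := t) hδ hR
  have hdρ := hasDerivAt_radius hz₀ hz₁ ((half_pos hδ0).trans_le hρ)
  have hm₀ := abs_fst_div_radius_le_one (shiftedCoord a₀ k t (radius (x t) (y t)) (x t))
    (shiftedCoord a₁ k t (radius (x t) (y t)) (y t))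
  have hm₁ := abs_snd_div_radius_le_one (shiftedCoord a₀ k t (radius (x t) (y t)) (x t))
    (shiftedCoord a₁ k t (radius (x t) (y t)) (y t))
  have hm := div_radius_sq_add_div_radius_sq ((half_pos hδ0).trans_le hρ)
  -- The dither has been removed from the shifted coordinates: their speed is bounded.
  have hspeed : ∀ {v a θ : ℝ}, |v| ≤ b → 0 < a → 1 / a ≤ C * τ →
      |v - k * d * (Real.cos θ / a)| ≤ b + k * (2 * b + 2 * C) * C := fun {v a θ} hv ha hi => by
    have h1 : |1 / a| ≤ C * τ := by rwa [abs_of_pos (by positivity)]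
    have h2 := abs_mul_le_mul_of_abs_le (le_refl |k * d|)
      (abs_mul_le_mul_of_abs_le (Real.abs_cos_le_one θ) h1)
    rw [mul_one_div, abs_mul k d, abs_of_pos hk] at h2
    have h3 := mul_le_mul_of_nonneg_left hdτ (mul_pos hk hC).le
    linarith [abs_sub v (k * d * (Real.cos θ / a))]
  have hB₀ := hspeed (θ := ditherPhase a₀ k t (radius (x t) (y t))) hf₀ h.pos₀ h.inv_le₀
  have hB₁ := hspeed (θ := ditherPhase a₁ k t (radius (x t) (y t))) hf₁ h.pos₁ h.inv_le₁
  have hBρ := (abs_add_le _ _).trans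
    (add_le_add (abs_mul_le_mul_of_abs_le hm₀ hB₀) (abs_mul_le_mul_of_abs_le hm₁ hB₁))
  rw [← two_mul, one_mul] at hBρ
  obtain ⟨m₀', hdm₀, hm₀'⟩ := exists_hasDerivAt_div hz₀ hdρ (half_pos hδ0) hρ hm₀ hB₀ hBρ
  obtain ⟨m₁', hdm₁, hm₁'⟩ := exists_hasDerivAt_div hz₁ hdρ (half_pos hδ0) hρ hm₁ hB₁ hBρ
  obtain ⟨w, hw, hwle⟩ := exists_hasDerivAt_averagingCorrection h hk hθ₀ hθ₁ hdm₀ hdm₁ hm₀ hm₁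
    hm₀' hm₁' hdτ
  refine ⟨_, hdρ.add (hw.const_mul (k / 2)), ?_⟩
  have hRρ := h.abs_radius_sub_shiftedDist_le k t (x t) (y t)
  have hCτ : C * τ ≤ 2 * C * τ := by nlinarith [mul_pos hC hτ]
  have hG : 2 * (2 * C * τ) / δ = 4 * C / δ * τ := by ring
  have hnm₀ := abs_div_sub_div_le hδ0 hR ((half_pos hδ0).trans_le hρ) hm₀
    ((abs_sub_shiftedCoord_le h.pos₀ h.inv_le₀ k t (radius (x t) (y t)) (x t)).trans hCτ) hRρ
  have hnm₁ := abs_div_sub_div_le hδ0 hR ((half_pos hδ0).trans_le hρ) hm₁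
    ((abs_sub_shiftedCoord_le h.pos₁ h.inv_le₁ k t (radius (x t) (y t)) (y t)).trans hCτ) hRρ
  rw [hG] at hnm₀ hnm₁
  have hrate := shiftedDist_rate_le h hk hb hm hm₀ hm₁ hn₀ hn₁ hnm₀ hnm₁ hf hf₀ hf₁ hd
  have hwle' := mul_le_mul_of_nonneg_left hwle (half_pos hk).le
  unfold esRateConst
  linarith

lemma contDiffAt_radius {E : Type*} [NormedAddCommGroup E] [NormedSpace ℝ E] {u v : E → ℝ} {q : E}
    (hu : ContDiffAt ℝ 1 u q) (hv : ContDiffAt ℝ 1 v q) (h : 0 < radius (u q) (v q)) :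
    ContDiffAt ℝ 1 (fun z => radius (u z) (v z)) q := by
  refine ContDiffAt.sqrt (by fun_prop) ?_
  rw [← radius_sq]
  positivity

lemma contDiffAt_averagingCorrection {E : Type*} [NormedAddCommGroup E] [NormedSpace ℝ E]
    {θ₀ θ₁ m₀ m₁ : E → ℝ} {q : E} (hθ₀ : ContDiffAt ℝ 1 θ₀ q) (hθ₁ : ContDiffAt ℝ 1 θ₁ q)
    (hm₀ : ContDiffAt ℝ 1 m₀ q) (hm₁ : ContDiffAt ℝ 1 m₁ q) :
    ContDiffAt ℝ 1 (fun z => averagingCorrection a₀ a₁ (θ₀ z) (θ₁ z) (m₀ z) (m₁ z)) q := by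
  unfold averagingCorrection
  fun_prop

lemma contDiffAt_esLyapunov {k : ℝ} {q : ℝ × ℝ × ℝ} (hR : 0 < radius q.2.1 q.2.2)
    (hρ : 0 < shiftedDist a₀ a₁ k q.1 q.2.1 q.2.2) :
    ContDiffAt ℝ 1 (fun q : ℝ × ℝ × ℝ => esLyapunov a₀ a₁ k q.1 q.2.1 q.2.2) q := by
  have h1 : ContDiffAt ℝ 1 (fun q : ℝ × ℝ × ℝ => radius q.2.1 q.2.2) q :=
    contDiffAt_radius (by fun_prop) (by fun_prop) hR
  have hθ : ∀ a : ℝ, ContDiffAt ℝ 1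
      (fun q : ℝ × ℝ × ℝ => ditherPhase a k q.1 (radius q.2.1 q.2.2)) q := fun a => by
    unfold ditherPhase; fun_prop
  have hz₀ : ContDiffAt ℝ 1
      (fun q : ℝ × ℝ × ℝ => shiftedCoord a₀ k q.1 (radius q.2.1 q.2.2) q.2.1) q := by
    have := hθ a₀
    unfold shiftedCoord; fun_prop
  have hz₁ : ContDiffAt ℝ 1
      (fun q : ℝ × ℝ × ℝ => shiftedCoord a₁ k q.1 (radius q.2.1 q.2.2) q.2.2) q := by
    have := hθ a₁
    unfold shiftedCoord; fun_prop
  have hd : ContDiffAt ℝ 1 (fun q : ℝ × ℝ × ℝ => shiftedDist a₀ a₁ k q.1 q.2.1 q.2.2) q :=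
    contDiffAt_radius hz₀ hz₁ hρ
  exact hd.add (contDiffAt_const.mul (contDiffAt_averagingCorrection (hθ a₀) (hθ a₁)
    (hz₀.div hd hρ.ne') (hz₁.div hd hρ.ne')))

end

/-! ### Trajectories of the closed loop -/

/-- A single constant controls the dither of `ωᵢ = rᵢ ω` for all `ω ≥ 1`, with `τ = 1 / √ω`. -/
lemma exists_isFastDither {r₀ r₁ : ℝ} (h₀ : 0 < r₀) (h₁ : 0 < r₁) (hne : r₀ ≠ r₁) :
    ∃ C, 1 ≤ C ∧ ∀ ω, 1 ≤ ω → IsFastDither √(r₀ * ω) √(r₁ * ω) (1 / √ω) C := by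
  have s0 := Real.sqrt_pos.2 h₀
  have s1 := Real.sqrt_pos.2 h₁
  have hsub : r₀ - r₁ ≠ 0 := sub_ne_zero.2 hne
  have i0 : 0 < 1 / √r₀ := by positivity
  have i1 : 0 < 1 / √r₁ := by positivity
  have ig : 0 ≤ |1 / (r₀ - r₁)| := abs_nonneg _
  refine ⟨1 + √r₀ + √r₁ + 1 / √r₀ + 1 / √r₁ + |1 / (r₀ - r₁)|, by linarith, fun ω hω => ?_⟩
  have hω0 : 0 < ω := by linarith
  have sω := Real.sqrt_pos.2 hω0
  have hgap : √(r₀ * ω) ^ 2 - √(r₁ * ω) ^ 2 = (r₀ - r₁) * ω := by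
    rw [Real.sq_sqrt (by positivity), Real.sq_sqrt (by positivity)]
    ring
  refine ⟨by positivity, by positivity, by positivity, ?_, by linarith, ?_, ?_, ?_, ?_, ?_, ?_⟩
  · rw [div_le_one sω]
    exact Real.one_le_sqrt.2 hω
  · rw [Real.sqrt_mul h₀.le, mul_assoc, mul_one_div_cancel sω.ne', mul_one]
    linarith
  · rw [Real.sqrt_mul h₁.le, mul_assoc, mul_one_div_cancel sω.ne', mul_one]
    linarith
  · rw [Real.sqrt_mul h₀.le, ← one_div_mul_one_div]
    gcongr
    linarith
  · rw [Real.sqrt_mul h₁.le, ← one_div_mul_one_div]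
    gcongr
    linarith
  · rw [hgap]
    exact mul_ne_zero hsub hω0.ne'
  · rw [hgap, one_div_pow, Real.sq_sqrt hω0.le, ← one_div_mul_one_div,
      abs_mul, abs_of_pos (one_div_pos.2 hω0)]
    gcongr
    linarith

lemma norm_eq_radius (v : Plane) : ‖v‖ = radius (v 0) (v 1) := by
  rw [EuclideanSpace.norm_eq, Fin.sum_univ_two, Real.norm_eq_abs, Real.norm_eq_abs, sq_abs, sq_abs]
  rfl

/-- The phase in the feedback for the gain `α = 1`. -/
lemma boundedES_one_apply {r : Fin 2 → ℝ} {k ω : ℝ} (i : Fin 2) (h : 0 ≤ r i * ω) (t y : ℝ) :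
    boundedES r k 1 ω t y i
      = √(r i * ω) * Real.cos (ditherPhase √(r i * ω) k t y) := by
  simp [boundedES, ditherPhase, Real.sq_sqrt h]

lemma exists_norm_pushField_le {f : Plane → Plane} {M : ℝ} (hf : ∀ x, ‖f x‖ ≤ M) (g : Plane)
    (r : Fin 2 → ℝ) (k α ω : ℝ) : ∃ V, ∀ t p, ‖pushField f g r k α ω t p‖ ≤ V := by
  refine ⟨M + (√(α * (r 0 * ω)) + √(α * (r 1 * ω))), fun t p => (norm_add_le _ _).trans
    (add_le_add (hf p) ?_)⟩
  have key : ∀ i, |boundedES r k α ω t (pushCost g p) i| ≤ √(α * (r i * ω)) := fun i => by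
    simpa [boundedES] using abs_mul_le_mul_of_abs_le (abs_of_nonneg (Real.sqrt_nonneg _)).le
      (Real.abs_cos_le_one (r i * ω * t + k * pushCost g p))
  rw [norm_eq_radius]
  have h := le_of_abs_le (abs_radius_sub_radius_le (boundedES r k α ω t (pushCost g p) 0)
    (boundedES r k α ω t (pushCost g p) 1) 0 0)
  have h0 : radius 0 0 = 0 := by simp [radius]
  rw [h0, sub_zero, sub_zero, sub_zero] at h
  exact h.trans (add_le_add (key 0) (key 1))

namespace IsESPushTrajectory

variable {f : Plane → Plane} {g : Plane} {r : Fin 2 → ℝ} {k α ω tc : ℝ} {p : ℝ → Plane}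

/-- Friction and feedback being bounded, trajectories are Lipschitz. -/
lemma exists_lipschitzOnWith (hp : IsESPushTrajectory f g r k α ω tc p) {M : ℝ}
    (hf : ∀ x, ‖f x‖ ≤ M) : ∃ K, LipschitzOnWith K p (Set.Ici tc) := by
  obtain ⟨V, hV⟩ := exists_norm_pushField_le hf g r k α ω
  have hV0 : 0 ≤ V := (norm_nonneg _).trans (hV 0 0)
  refine ⟨⟨V, hV0⟩, LipschitzOnWith.of_dist_le_mul fun s hs t ht => ?_⟩
  rw [dist_eq_norm, hp.eq_integral s hs, hp.eq_integral t ht, add_sub_add_left_eq_sub,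
    intervalIntegral.integral_interval_sub_left (hp.intervalIntegrable s hs)
      (hp.intervalIntegrable t ht), Real.dist_eq]
  exact intervalIntegral.norm_integral_le_of_norm_le_const fun u _ => hV u (p u)

lemma ae_hasDerivAt (hp : IsESPushTrajectory f g r k α ω tc p) (T : ℝ) :
    ∀ᵐ u, u ∈ Set.Icc tc T → HasDerivAt p (pushField f g r k α ω u (p u)) u := by
  rcases lt_or_ge T tc with hT | hT
  · exact Filter.Eventually.of_forall fun u hu => absurd (hu.1.trans hu.2) (not_le.2 hT)
  · have hne : ∀ᵐ u : ℝ, u ≠ tc := by simp [ae_iff, measure_singleton]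
    filter_upwards [(hp.intervalIntegrable T hT).ae_hasDerivAt_integral, hne] with u hu hutc hmem
    rw [Set.uIcc_of_le hT] at hu
    have hlt : tc < u := lt_of_le_of_ne hmem.1 (Ne.symm hutc)
    refine ((hu hmem tc ⟨le_rfl, hT⟩).const_add (p tc)).congr_of_eventuallyEq ?_
    filter_upwards [Ioi_mem_nhds hlt] with v hv
    exact hp.eq_integral v (le_of_lt hv)

lemma exists_lipschitzOnWith_graph (hp : IsESPushTrajectory f g r k α ω tc p) {M : ℝ}
    (hf : ∀ x, ‖f x‖ ≤ M) :
    ∃ K, LipschitzOnWith K (fun u => ((u, (p u - g) 0, (p u - g) 1) : ℝ × ℝ × ℝ))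
      (Set.Ici tc) := by
  obtain ⟨K, hK⟩ := hp.exists_lipschitzOnWith hf
  have hcoord : ∀ i : Fin 2, LipschitzOnWith K (fun u => (p u - g) i) (Set.Ici tc) := fun i => by
    refine LipschitzOnWith.of_dist_le_mul fun u hu v hv => (le_trans ?_ (hK.dist_le_mul u hu v hv))
    rw [dist_eq_norm, dist_eq_norm, ← sub_sub_sub_cancel_right (p u) (p v) g]
    exact PiLp.norm_apply_le ((p u - g) - (p v - g)) i
  exact ⟨_, LipschitzWith.id.lipschitzOnWith.prodMk ((hcoord 0).prodMk (hcoord 1))⟩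

lemma hasDerivAt_coord (hr : ∀ i, 0 < r i) (hω : 0 < ω) {u : ℝ}
    (hu : HasDerivAt p (pushField f g r k 1 ω u (p u)) u) (i : Fin 2) :
    HasDerivAt (fun v => (p v - g) i) (f (p u) i + √(r i * ω)
      * Real.cos (ditherPhase √(r i * ω) k u (radius ((p u - g) 0) ((p u - g) 1)))) u := by
  have h := (EuclideanSpace.proj (𝕜 := ℝ) i).hasFDerivAt.comp_hasDerivAt u (hu.sub_const g)
  refine h.congr_deriv ?_
  rw [← norm_eq_radius, ← boundedES_one_apply i (mul_pos (hr i) hω).le]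
  rfl

/-- Decrease of the distance to the goal, up to the size of the averaging terms, while the object
is away from the goal. -/
lemma norm_sub_le {M b C δ : ℝ} (hp : IsESPushTrajectory f g r k 1 ω tc p)
    (hr : ∀ i, 0 < r i) (hω : 0 < ω) (hf : ∀ x, ‖f x‖ ≤ M) (hMb : M ≤ b)
    (hfast : IsFastDither √(r 0 * ω) √(r 1 * ω) (1 / √ω) C) (hk : k = 2 * (b + 2))
    (hδ0 : 0 < δ) (hδ : 4 * C * (1 / √ω) ≤ δ) (hrate : esRateConst b k C δ * (1 / √ω) ≤ 1)
    {s t : ℝ} (hs : tc ≤ s) (hst : s ≤ t) (haway : ∀ u ∈ Set.Icc s t, δ ≤ ‖p u - g‖) :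
    ‖p t - g‖ ≤ ‖p s - g‖ + 2 * ((2 * C + k / 2 * ((2 + 4 * C ^ 2) * C ^ 2)) * (1 / √ω))
      - (t - s) := by
  have hb : 0 ≤ b := ((norm_nonneg _).trans (hf 0)).trans hMb
  have hk0 : 0 < k := by rw [hk]; linarith
  obtain ⟨K, hK⟩ := hp.exists_lipschitzOnWith_graph hf
  have hrad : ∀ u ∈ Set.Icc s t, δ ≤ radius ((p u - g) 0) ((p u - g) 1) := fun u hu => by
    rw [← norm_eq_radius]
    exact haway u hu
  have hderiv : ∀ᵐ u, u ∈ Set.Icc s t → ∃ w, HasDerivAt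
      (fun v => esLyapunov √(r 0 * ω) √(r 1 * ω) k v ((p v - g) 0) ((p v - g) 1)) w u
        ∧ w ≤ -1 := by
    filter_upwards [hp.ae_hasDerivAt t] with u hu hmem
    have hdu := hu ⟨hs.trans hmem.1, hmem.2⟩
    have hfb : f (p u) 0 ^ 2 + f (p u) 1 ^ 2 ≤ b ^ 2 := by
      rw [← radius_sq, ← norm_eq_radius]
      exact pow_le_pow_left₀ (norm_nonneg _) ((hf _).trans hMb) 2
    obtain ⟨w, hw, hwle⟩ := exists_hasDerivAt_esLyapunov (x := fun v => (p v - g) 0)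
      (y := fun v => (p v - g) 1) hfast hk0 hb hδ0 hδ hfb (hrad u hmem)
      (hasDerivAt_coord hr hω hdu 0) (hasDerivAt_coord hr hω hdu 1)
    exact ⟨w, hw, by linarith⟩
  have hW := comp_le_comp_sub_of_ae_hasDerivAt_le
    (γ := fun u => ((u, (p u - g) 0, (p u - g) 1) : ℝ × ℝ × ℝ))
    (F := fun q : ℝ × ℝ × ℝ => esLyapunov √(r 0 * ω) √(r 1 * ω) k q.1 q.2.1 q.2.2) hst
    (hK.mono fun u hu => hs.trans hu.1)
    (fun u hu => contDiffAt_esLyapunov (q := (u, (p u - g) 0, (p u - g) 1))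
      (hδ0.trans_le (hrad u hu))
      ((half_pos hδ0).trans_le (hfast.half_le_shiftedDist hδ (hrad u hu)))) hderiv
  have hs' := le_of_abs_le (hfast.abs_esLyapunov_sub_radius_le hk0 s ((p s - g) 0) ((p s - g) 1))
  have ht' := neg_le_of_abs_le
    (hfast.abs_esLyapunov_sub_radius_le hk0 t ((p t - g) 0) ((p t - g) 1))
  rw [norm_eq_radius, norm_eq_radius]
  dsimp only at hW
  linarith

end IsESPushTrajectory

theorem mainTheorem1 (r : Fin 2 → ℝ) (hr_pos : ∀ i, 0 < r i) (hr_ne : r 0 ≠ r 1)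
    (M : ℝ) (ε : ℝ) (hε : 0 < ε) :
    ∃ k α ωstar : ℝ, 0 < k ∧ 0 < α ∧ 0 < ωstar ∧
      ∀ ω : ℝ, ωstar < ω →
        ∀ (f : Plane → Plane), (∀ x, ‖f x‖ ≤ M) →
          ∀ (g : Plane) (tc : ℝ) (p : ℝ → Plane), IsESPushTrajectory f g r k α ω tc p →
            ∃ T : ℝ, tc ≤ T ∧ ∀ t : ℝ, T ≤ t → ‖p t - g‖ < ε := by
  obtain ⟨C, hC1, hC⟩ := exists_isFastDither (hr_pos 0) (hr_pos 1) hr_ne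
  obtain ⟨k, hk⟩ : ∃ k, k = 2 * (|M| + 2) := ⟨_, rfl⟩
  have hk0 : 0 < k := by rw [hk]; positivity
  obtain ⟨c, hc⟩ : ∃ c, c = 2 * C + k / 2 * ((2 + 4 * C ^ 2) * C ^ 2) := ⟨_, rfl⟩
  have hc0 : 0 < c := by rw [hc]; positivity
  -- With `δ = ε / 4`, three smallness conditions on `1 / √ω` are needed: removing the
  -- dither shifts the object by at most `δ / 2`, the error in the decrease rate is at most `1`, and
  -- the Lyapunov function is within `δ / 2` of the distance.
  obtain ⟨S, hS⟩ : ∃ S, S = 1 + 4 * C / (ε / 4) + |esRateConst |M| k C (ε / 4)| + 2 * c / (ε / 4) :=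
    ⟨_, rfl⟩
  have p1 : 0 ≤ 4 * C / (ε / 4) := by positivity
  have p2 : 0 ≤ |esRateConst |M| k C (ε / 4)| := abs_nonneg _
  have p3 : 0 ≤ 2 * c / (ε / 4) := by positivity
  refine ⟨k, 1, S ^ 2, hk0, one_pos, by rw [hS]; positivity, fun ω hω f hf g tc p hp => ?_⟩
  have hS1 : 1 ≤ S := by linarith
  have hω1 : 1 ≤ ω := by nlinarith
  have hSω : S ≤ √ω := Real.le_sqrt_of_sq_le hω.le
  have hsω : 0 < √ω := by linarith
  have hfast := hC ω hω1
  have hδ : 4 * C * (1 / √ω) ≤ ε / 4 := by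
    rw [mul_one_div, div_le_iff₀ hsω, mul_comm (ε / 4), ← div_le_iff₀ (by positivity)]
    linarith
  have hη : 2 * (c * (1 / √ω)) ≤ ε / 4 := by
    rw [← mul_assoc, mul_one_div, div_le_iff₀ hsω, mul_comm (ε / 4), ← div_le_iff₀ (by positivity)]
    linarith
  have hrate : esRateConst |M| k C (ε / 4) * (1 / √ω) ≤ 1 := by
    rw [mul_one_div, div_le_one hsω]
    linarith [le_abs_self (esRateConst |M| k C (ε / 4))]
  obtain ⟨K, hK⟩ := hp.exists_lipschitzOnWith hf
  obtain ⟨T, hT, h⟩ := exists_forall_le_add_of_decrease (R := fun t => ‖p t - g‖) (tc := tc)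
    (δ := ε / 4) (η := 2 * (c * (1 / √ω))) (hK.continuousOn.sub continuousOn_const).norm
    (fun t => norm_nonneg _) (by positivity) (fun s t hs hst haway => by
      rw [hc]
      exact hp.norm_sub_le hr_pos (by linarith) hf (le_abs_self M) hfast hk (by positivity) hδ
        hrate hs hst haway)
  exact ⟨T, hT, fun t ht => by linarith [h t ht]⟩
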